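/- Let $n\ge 2$ be an integer, $R_0=\mathbb{Q}[x_1,\dots,x_n]$, $T=\mathbb{Q}[[x_1,\dots,x_n]]$ and $M=(x_1,\dots,x_n)T$. For a subring $R\subseteq T$ we say that $(R,R\cap M)$ is quasi-local if $R$ has a unique maximal ideal and this ideal is $R\cap M$, and that $R$ has completion $T$ if the inclusion $R\subseteq T$ induces an isomorphism from the $(R\cap M)$-adic completion of $R$ onto $T$. Call a subring $S\subseteq T$ a *base ring* if $S$ is countable, $R_0\subseteq S$, $(S,S\cap M)$ is quasi-local, $S$ is a (Noetherian) regular local ring with completion $T$, and $S$ contains all its factors: whenever $0\neq s\in S$ and $s\in pT$ for a prime element $p$ of $T$, there is a unit $u$ of $T$ with $pu\in S$. Given a base ring $S$, call a subring $B\subseteq T$ a *final ring over $S$* if $B$ is uncountable, $(B,B\cap M)$ is quasi-local, $S\subseteq B$, every prime ideal $P$ of $T$ with $P\cap S=(0)$ satisfies $P\cap B=(0)$, and $IT\cap B=I$ for every principal ideal $I$ of $B$. **Theorem.** Base rings exist, and over every base ring $S$ there exists a final ring. Moreover, if $S$ is any base ring and $B$ is any final ring over $S$, then: 1. every finitely generated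 ideal of $B$ is generated by finitely many elements of $S$, i.e. $I=(p_1,\dots,p_k)B$ with $p_1,\dots,p_k\in S$; 2. $IT\cap B=I$ for every finitely generated ideal $I$ of $B$; 3. $B$ is Noetherian, $B$ has completion $T$, and $B$ is a regular local ring. -/

import Mathlib

namespace PowerSeriesSubrings

/-- The power series ring `T = ℚ[[x_1, …, x_n]]`. -/
abbrev T (n : ℕ) : Type := MvPowerSeries (Fin n) ℚ

/-- The ideal `M = (x_1, …, x_n)T`. -/
noncomputable def M (n : ℕ) : Ideal (T n) :=
  Ideal.span (Set.range (fun i : Fin n => (MvPowerSeries.X i : T n)))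

/-- The polynomial ring `R₀ = ℚ[x_1, …, x_n]`, as a subring of `T`. -/
noncomputable def R₀ (n : ℕ) : Subring (T n) :=
  (MvPolynomial.coeToMvPowerSeries.ringHom : MvPolynomial (Fin n) ℚ →+* T n).range

variable {n : ℕ}

/-- The ideal `R ∩ M` of a subring `R` of `T`. -/
noncomputable def interM (R : Subring (T n)) : Ideal R := (M n).comap R.subtype

/-- The extension `IT` of an ideal `I` of a subring `R` of `T`. -/
noncomputable def extend (R : Subring (T n)) (I : Ideal R) : Ideal (T n) := I.map R.subtype

/-- The contraction `J ∩ R` to a subring `R` of an ideal `J` of `T`. -/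
noncomputable def contract (R : Subring (T n)) (J : Ideal (T n)) : Ideal R := J.comap R.subtype

/-- `(R, R ∩ M)` is quasi-local: `R` has a unique maximal ideal, and it is `R ∩ M`. -/
def IsQuasiLocal (R : Subring (T n)) : Prop :=
  IsLocalRing R ∧ (interM R).IsMaximal

/-- `T` is the completion of `(R, R ∩ M)`: the `(R ∩ M)`-adic completion of `R` is isomorphic to
`T` by an isomorphism that is compatible with the maps from `R`, the map `R → T` being the
inclusion. -/
def HasCompletionT (R : Subring (T n)) : Prop :=
  Nonempty (AdicCompletion (interM R) R ≃ₐ[R] T n)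

/-- `R` contains all its factors: whenever a nonzero `r ∈ R` lies in `pT` for a prime element `p`
of `T`, some associate `pu` of `p` lies in `R`. -/
def ContainsFactors (R : Subring (T n)) : Prop :=
  ∀ r ∈ R, r ≠ 0 → ∀ p : T n, Prime p → r ∈ Ideal.span {p} → ∃ u : T n, IsUnit u ∧ p * u ∈ R

/-- `R` is an `S^⋆`-subring of `T`. -/
def IsStarSubring (S R : Subring (T n)) : Prop :=
  S ≤ R ∧ ∀ P : Ideal (T n), P.IsPrime → contract S P = ⊥ → contract R P = ⊥

/-- The defining properties of the base ring `S`. -/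
structure IsBaseRing (S : Subring (T n)) : Prop where
  countable : (S : Set (T n)).Countable
  polynomials_le : R₀ n ≤ S
  quasiLocal : IsQuasiLocal S
  regular : IsRegularLocalRing S
  completion : HasCompletionT S
  containsFactors : ContainsFactors S

/-- The defining properties of the final ring `B` over the base ring `S`. -/
structure IsFinalRing (S B : Subring (T n)) : Prop where
  uncountable : ¬ (B : Set (T n)).Countable
  quasiLocal : IsQuasiLocal B
  starSubring : IsStarSubring S B
  principal_closed : ∀ I : Ideal B, I.IsPrincipal → contract B (extend B I) = I

end PowerSeriesSubrings

/-! ### Weierstrass polynomials and unique factorization -/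

/-! Everything rests on one property of a subring `R ⊇ R₀`: `IT ∩ R = I` for all finitely generated
ideals `I`. It makes `R` Noetherian, because `T` is; it makes `T` the completion, because `(R ∩ M)^k
= M^k ∩ R` and polynomials are dense in `T`; for quasi-local `R` it gives regularity, because the
maximal ideal is generated by the `n` variables while the dimension is at least `n`. Conversely, a
Noetherian quasi-local `R ⊇ R₀` with completion `T` has the property by Krull's intersection
theorem.

For a final ring `B`, factor `b ∈ B` in the factorial ring `T`. If a prime `p` divides `b ≠ 0`, then
`pT` meets `B`, hence `S`, nontrivially, so `S` contains an associate of `p`. Thus `b` is associated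
in `T` to some `s ∈ S`, and `bB = sB` (`IsFinalRing.exists_mem_span_singleton_eq`). The property for
`B` is thereby reduced to that for `S` (`IsFinalRing.contract_extend`).

A base ring is obtained by closing `R₀` under countably many operations. A final ring is a maximal
subring `B ⊇ S` all of whose elements are associated in `T` to elements of `S`; a countable one
could be enlarged by a suitable transcendental limit (`exists_transcendental_aeval_associated`). -/

-- Over the residue field `P` becomes a power of `X`, whose monic divisors are again powers of `X`.
open IsLocalRing in
theorem Polynomial.IsDistinguishedAt.of_monic_of_dvd {A : Type*} [CommRing A] [IsLocalRing A]
    {P Q : Polynomial A} (hP : P.IsDistinguishedAt (maximalIdeal A)) (hQ : Q.Monic)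
    (hdvd : Q ∣ P) : Q.IsDistinguishedAt (maximalIdeal A) := by
  have hmap : Q.map (residue A) ∣ Polynomial.X ^ P.natDegree := by
    have h := Polynomial.map_dvd (residue A) hdvd
    rwa [show P.map (residue A) = Polynomial.X ^ P.natDegree from hP.map_eq_X_pow] at h
  obtain ⟨i, -, hi⟩ := (dvd_prime_pow Polynomial.prime_X _).1 hmap
  have heq := Polynomial.eq_of_monic_of_associated (hQ.map _) (Polynomial.monic_X_pow i) hi
  have hdeg : Q.natDegree = i := by
    rw [← hQ.natDegree_map (residue A), heq, Polynomial.natDegree_X_pow]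
  refine ⟨⟨fun {k} hk => ?_⟩, hQ⟩
  have h := congrArg (fun p => Polynomial.coeff p k) heq
  simp only [Polynomial.coeff_map, Polynomial.coeff_X_pow] at h
  rw [if_neg (by omega)] at h
  exact (residue_eq_zero_iff _).1 h

/-- By Weierstrass division, `A[X]/(Q)` and `A[[X]]/(Q)` are isomorphic. -/
theorem Polynomial.IsDistinguishedAt.prime_coe {A : Type*} [CommRing A]
    {Q : Polynomial A} {I : Ideal A} [IsAdicComplete I A] (hQ : Q.IsDistinguishedAt I)
    (hp : Prime Q) : Prime (Q : PowerSeries A) := by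
  have h0 : (Q : PowerSeries A) ≠ 0 := fun h => hp.ne_zero (Polynomial.coe_eq_zero_iff.1 h)
  rw [← Ideal.span_singleton_prime h0, ← Ideal.Quotient.isDomain_iff_prime]
  have : IsDomain (Polynomial A ⧸ Ideal.span {Q}) :=
    (Ideal.Quotient.isDomain_iff_prime _).2 ((Ideal.span_singleton_prime hp.ne_zero).2 hp)
  exact hQ.algEquivQuotient.symm.toMulEquiv.isDomain _

theorem Polynomial.exists_monic_associated {A : Type*} [CommRing A] [IsDomain A]
    {Q : Polynomial A} (hlc : IsUnit Q.leadingCoeff) :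
    ∃ Q' : Polynomial A, Q'.Monic ∧ Associated Q Q' := by
  obtain ⟨c, hc⟩ := hlc
  have hu : IsUnit (Polynomial.C (↑c⁻¹ : A)) := Polynomial.isUnit_C.2 c⁻¹.isUnit
  refine ⟨Q * Polynomial.C (↑c⁻¹ : A), ?_, (associated_mul_unit_right Q _ hu)⟩
  rw [Polynomial.Monic, Polynomial.leadingCoeff_mul, Polynomial.leadingCoeff_C, ← hc,
    Units.mul_inv]

/-- Some prime factor of `P` lies in `I`; its leading coefficient divides 1, so it can be made
monic. -/
theorem Polynomial.Monic.exists_prime_dvd_mem {A : Type*} [CommRing A] [IsDomain A]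
    [UniqueFactorizationMonoid A] {P : Polynomial A} (hP : P.Monic) {I : Ideal (Polynomial A)}
    (hI : I.IsPrime) (hPI : P ∈ I) :
    ∃ Q : Polynomial A, Q.Monic ∧ Q ∣ P ∧ Prime Q ∧ Q ∈ I := by
  obtain ⟨f, hf, v, hv⟩ := UniqueFactorizationMonoid.exists_prime_factors P hP.ne_zero
  have hprod : f.prod ∈ I := by
    rwa [← Ideal.mul_unit_mem_iff_mem I v.isUnit, hv]
  obtain ⟨Q, hQf, hQI⟩ := (hI.multiset_prod_mem_iff_exists_mem f).1 hprod
  have hQP : Q ∣ P := (Multiset.dvd_prod hQf).trans ⟨v, hv.symm⟩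
  have hlc : IsUnit Q.leadingCoeff := by
    obtain ⟨R, rfl⟩ := hQP
    have h : (Q * R).leadingCoeff = 1 := hP
    rw [Polynomial.leadingCoeff_mul] at h
    exact IsUnit.of_mul_eq_one _ h
  obtain ⟨Q', hQ', hassoc⟩ := Polynomial.exists_monic_associated hlc
  exact ⟨Q', hQ', hassoc.symm.dvd.trans hQP, hassoc.prime (hf Q hQf),
    Ideal.mem_of_dvd I hassoc.dvd hQI⟩

-- Weierstrass preparation replaces `g` by a distinguished polynomial, which is factored in the
-- factorial ring `A[X]`.
open IsLocalRing in
theorem PowerSeries.exists_prime_mem_of_map_residue_ne_zero {A : Type*} [CommRing A] [IsDomain A]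
    [IsLocalRing A] [UniqueFactorizationMonoid A] [IsAdicComplete (maximalIdeal A) A]
    {I : Ideal (PowerSeries A)} (hI : I.IsPrime) {g : PowerSeries A} (hg : g ∈ I)
    (hg0 : PowerSeries.map (residue A) g ≠ 0) : ∃ q ∈ I, Prime q := by
  obtain ⟨P, u, hP⟩ := PowerSeries.exists_isWeierstrassFactorization hg0
  have hPI : (P : PowerSeries A) ∈ I := by
    rw [hP.eq_mul] at hg
    exact (I.mul_unit_mem_iff_mem hP.isUnit).1 hg
  obtain ⟨Q, hQm, hQP, hQ, hQI⟩ := hP.isDistinguishedAt.monic.exists_prime_dvd_mem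
    (Ideal.comap_isPrime (Polynomial.coeToPowerSeries.ringHom (R := A)) I) hPI
  exact ⟨Q, hQI, (hP.isDistinguishedAt.of_monic_of_dvd hQm hQP).prime_coe hQ⟩

/-! ### Linear changes of coordinates -/

namespace MvPowerSeries

/-- The substitution `x₀ ↦ b₀ x₀`, `xᵢ ↦ xᵢ + bᵢ x₀`. -/
noncomputable def shearVars {n : ℕ} {k : Type*} [Field k] (b : Fin (n + 1) → k) :
    Fin (n + 1) → MvPowerSeries (Fin (n + 1)) k :=
  fun i => (if i = 0 then 0 else X i) + C (b i) * X 0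

theorem hasSubst_shearVars {n : ℕ} {k : Type*} [Field k] (b : Fin (n + 1) → k) :
    HasSubst (shearVars b) := by
  refine hasSubst_of_constantCoeff_zero fun i => ?_
  by_cases h : i = 0 <;> simp [shearVars, h]

theorem subst_shearVars_subst_shearVars {n : ℕ} {k : Type*} [Field k] {b c : Fin (n + 1) → k}
    (h0 : b 0 * c 0 = 1) (h : ∀ i ≠ 0, c i + b i * c 0 = 0) (f : MvPowerSeries (Fin (n + 1)) k) :
    subst (shearVars c) (subst (shearVars b) f) = f := by
  have key : (fun s => subst (shearVars c) (shearVars b s)) =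
      (X : Fin (n + 1) → MvPowerSeries (Fin (n + 1)) k) := by
    funext s
    have hc := hasSubst_shearVars c
    have e : ∀ a : k, subst (shearVars c) (C a : MvPowerSeries (Fin (n + 1)) k) = C a :=
      fun a => subst_C a
    by_cases hs : s = 0
    · subst hs
      simp only [shearVars, if_true, zero_add]
      rw [subst_mul hc, e, subst_X hc]
      simp only [shearVars, if_true, zero_add]
      rw [← mul_assoc, ← map_mul, h0, map_one, one_mul]
    · simp only [shearVars, if_neg hs]
      rw [subst_add hc, subst_mul hc, e, subst_X hc, subst_X hc]
      simp only [shearVars, if_neg hs, if_true, zero_add]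
      rw [add_assoc, ← mul_assoc, ← map_mul, ← add_mul, ← map_add, h s hs, map_zero, zero_mul,
        add_zero]
  rw [subst_comp_subst_apply (hasSubst_shearVars b) (hasSubst_shearVars c), key, subst_self, id]

/-- The linear change of coordinates `x₀ ↦ b₀ x₀`, `xᵢ ↦ xᵢ + bᵢ x₀` for `b₀ ≠ 0`. -/
noncomputable def shear {n : ℕ} {k : Type*} [Field k] (b : Fin (n + 1) → k) (hb : b 0 ≠ 0) :
    MvPowerSeries (Fin (n + 1)) k ≃+* MvPowerSeries (Fin (n + 1)) k where
  toFun := subst (shearVars b)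
  invFun := subst (shearVars fun i => if i = 0 then (b 0)⁻¹ else -(b i * (b 0)⁻¹))
  left_inv f := subst_shearVars_subst_shearVars (by simp [hb]) (fun i hi => by simp [hi]) f
  right_inv f := subst_shearVars_subst_shearVars (by simp [hb])
    (fun i hi => by simp [hi, hb]) f
  map_mul' := subst_mul (hasSubst_shearVars b)
  map_add' := subst_add (hasSubst_shearVars b)

/-- The point `(x₀, 0, …, 0)`. -/
noncomputable def axisVars (n : ℕ) (k : Type*) [Field k] :
    Fin (n + 1) → MvPowerSeries (Fin (n + 1)) k :=
  fun i => if i = 0 then X 0 else 0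

theorem hasSubst_axisVars (n : ℕ) (k : Type*) [Field k] : HasSubst (axisVars n k) := by
  refine hasSubst_of_constantCoeff_zero fun i => ?_
  by_cases h : i = 0 <;> simp [axisVars, h]

theorem subst_axisVars_eq_zero {n : ℕ} {k : Type*} [Field k] {f : MvPowerSeries (Fin (n + 1)) k}
    (hf : ∀ d : ℕ, coeff (Finsupp.single 0 d) f = 0) : subst (axisVars n k) f = 0 := by
  ext e
  rw [coeff_subst (hasSubst_axisVars n k), map_zero]
  refine finsum_eq_zero_of_forall_eq_zero fun m => ?_
  by_cases hm : m = Finsupp.single 0 (m 0)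
  · rw [hm, hf, zero_smul]
  · obtain ⟨i, hi⟩ : ∃ i, i ≠ 0 ∧ m i ≠ 0 := by
      by_contra! h
      refine hm (Finsupp.ext fun i => ?_)
      by_cases hi : i = 0
      · simp [hi]
      · rw [h i hi, Finsupp.single_eq_of_ne hi]
    have : (m.prod fun s e => axisVars n k s ^ e) = 0 := by
      rw [Finsupp.prod]
      exact Finset.prod_eq_zero (Finsupp.mem_support_iff.2 hi.2)
        (by simp [axisVars, hi.1, hi.2])
    rw [this, map_zero, smul_zero]

/-- The shear carries the first axis to the line spanned by `b`. -/
theorem subst_axisVars_shear {n : ℕ} {k : Type*} [Field k] (b : Fin (n + 1) → k) (hb : b 0 ≠ 0)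
    (f : MvPowerSeries (Fin (n + 1)) k) :
    subst (axisVars n k) (shear b hb f) =
      subst (fun i => C (b i) * X 0 : Fin (n + 1) → MvPowerSeries (Fin (n + 1)) k) f := by
  change subst (axisVars n k) (subst (shearVars b) f) = _
  rw [subst_comp_subst_apply (hasSubst_shearVars b) (hasSubst_axisVars n k)]
  congr 1
  funext s
  have hc := hasSubst_axisVars n k
  have e : ∀ a : k, subst (axisVars n k) (C a : MvPowerSeries (Fin (n + 1)) k) = C a :=
    fun a => subst_C a
  by_cases hs : s = 0
  · subst hs
    simp only [shearVars, if_true, zero_add]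
    rw [subst_mul hc, e, subst_X hc]
    simp [axisVars]
  · simp only [shearVars, if_neg hs]
    rw [subst_add hc, subst_mul hc, e, subst_X hc, subst_X hc]
    simp [axisVars, hs]

/-- On this line, the degree `d` coefficient is the degree `d` homogeneous part of `f` evaluated at
`b`. -/
theorem coeff_subst_line {n : ℕ} {k : Type*} [Field k] (b : Fin (n + 1) → k)
    (f : MvPowerSeries (Fin (n + 1)) k) (d : ℕ) :
    coeff (Finsupp.single 0 d)
      (subst (fun i => C (b i) * X 0 : Fin (n + 1) → MvPowerSeries (Fin (n + 1)) k) f) =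
      ∑ m ∈ Finset.univ.finsuppAntidiag d, coeff m f * ∏ i, b i ^ m i := by
  have hs : HasSubst (fun i => C (b i) * X 0 : Fin (n + 1) → MvPowerSeries (Fin (n + 1)) k) :=
    hasSubst_of_constantCoeff_zero fun i => by simp
  have hterm : ∀ m : Fin (n + 1) →₀ ℕ, coeff m f • coeff (Finsupp.single 0 d)
      (m.prod fun s e => ((C (b s) * X 0 : MvPowerSeries (Fin (n + 1)) k)) ^ e) =
      if m ∈ Finset.univ.finsuppAntidiag d then coeff m f * ∏ i, b i ^ m i else 0 := by
    intro m
    have : (m.prod fun s e => ((C (b s) * X 0 : MvPowerSeries (Fin (n + 1)) k)) ^ e) =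
        monomial (Finsupp.single 0 (∑ i, m i)) (∏ i, b i ^ m i) := by
      rw [Finsupp.prod_fintype _ _ (by simp)]
      simp only [mul_pow, Finset.prod_mul_distrib, ← map_pow, ← map_prod,
        Finset.prod_pow_eq_pow_sum]
      rw [X_pow_eq, ← monomial_zero_eq_C_apply, monomial_mul_monomial, zero_add, mul_one]
    rw [this, coeff_monomial, smul_eq_mul]
    have hiff : Finsupp.single (0 : Fin (n + 1)) d = Finsupp.single 0 (∑ i, m i) ↔
        m ∈ Finset.univ.finsuppAntidiag d := by
      rw [(Finsupp.single_injective (0 : Fin (n + 1))).eq_iff, Finset.mem_finsuppAntidiag']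
      simp [Finsupp.sum_fintype, eq_comm]
    by_cases h : m ∈ Finset.univ.finsuppAntidiag d
    · rw [if_pos h, if_pos (hiff.2 h)]
    · rw [if_neg h, if_neg (mt hiff.1 h), mul_zero]
  rw [coeff_subst hs]
  simp_rw [hterm]
  rw [finsum_eq_sum_of_support_subset (s := Finset.univ.finsuppAntidiag d) _ (by
    intro m hm
    by_contra h
    exact hm (if_neg h))]
  exact Finset.sum_congr rfl fun m hm => if_pos hm

/-- A nonzero power series over an infinite field becomes regular in the first variable after
some linear change of coordinates. -/
theorem exists_shear_coeff_ne_zero {n : ℕ} {k : Type*} [Field k] [Infinite k]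
    {f : MvPowerSeries (Fin (n + 1)) k} (hf : f ≠ 0) :
    ∃ (b : Fin (n + 1) → k) (hb : b 0 ≠ 0) (d : ℕ),
      coeff (Finsupp.single 0 d) (shear b hb f) ≠ 0 := by
  obtain ⟨m, hm⟩ : ∃ m, coeff m f ≠ 0 := by
    by_contra! h
    exact hf (ext fun m => by simp [h m])
  set d := ∑ i, m i
  set p : MvPolynomial (Fin (n + 1)) k :=
    ∑ l ∈ Finset.univ.finsuppAntidiag d, MvPolynomial.monomial l (coeff l f)
  have hp : p ≠ 0 := by
    intro h
    have h' := congrArg (MvPolynomial.coeff m) h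
    rw [MvPolynomial.coeff_sum, MvPolynomial.coeff_zero, Finset.sum_eq_single m] at h'
    · simp [hm] at h'
    · intro l _ hl
      simp [MvPolynomial.coeff_monomial, hl]
    · intro h''
      exact absurd (by simp [d]) h''
  -- The extra factor `X 0` forces `b 0 ≠ 0` at the chosen point.
  have hp' : p * MvPolynomial.X 0 ≠ 0 := mul_ne_zero hp (MvPolynomial.X_ne_zero 0)
  obtain ⟨b, hb⟩ : ∃ b, MvPolynomial.eval b (p * MvPolynomial.X 0) ≠ 0 := by
    by_contra! h
    exact hp' (MvPolynomial.funext fun x => by rw [h x, map_zero])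
  rw [map_mul, MvPolynomial.eval_X] at hb
  have hb0 : b 0 ≠ 0 := right_ne_zero_of_mul hb
  refine ⟨b, hb0, ?_⟩
  by_contra! h
  have hz := subst_axisVars_eq_zero h
  rw [subst_axisVars_shear] at hz
  have hc := congrArg (coeff (Finsupp.single 0 d)) hz
  rw [coeff_subst_line, map_zero] at hc
  refine left_ne_zero_of_mul hb ?_
  rw [← hc, map_sum]
  refine Finset.sum_congr rfl fun l _ => ?_
  rw [MvPolynomial.eval_monomial, Finsupp.prod_fintype _ _ (by simp)]

/-! ### The maximal ideal of a power series ring -/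

theorem mem_span_range_X_iff {n : ℕ} {k : Type*} [Field k] {f : MvPowerSeries (Fin n) k} :
    f ∈ Ideal.span (Set.range (X : Fin n → MvPowerSeries (Fin n) k)) ↔ constantCoeff f = 0 := by
  constructor
  · intro h
    have hle : Ideal.span (Set.range (X : Fin n → MvPowerSeries (Fin n) k)) ≤
        RingHom.ker (constantCoeff (σ := Fin n) (R := k)) := by
      rw [Ideal.span_le]
      rintro _ ⟨i, rfl⟩
      simp
    exact hle h
  · intro h
    -- In the completion of the polynomial ring, the kernel of the projection to level one is
    -- generated by the variables.
    set e := (toAdicCompletionAlgEquiv (Fin n) k).toRingEquiv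
    have hmap : Ideal.map e (Ideal.span (Set.range X)) =
        (MvPolynomial.idealOfVars (Fin n) k).map (algebraMap _ _) := by
      simp_rw [Ideal.map_span, ← Set.range_comp]
      congr 2
      ext1
      simp [e, AdicCompletion.algebraMap_apply, ← MvPolynomial.coe_X, toAdicCompletion_coe]
    have hef : e f ∈ Ideal.map e (Ideal.span (Set.range X)) := by
      rw [hmap, ← AdicCompletion.ker_evalOneₐ_eq_map _ (MvPolynomial.idealOfVars_fg _ _)]
      have h1 : truncTotal 1 f = 0 := by
        ext m
        by_cases hm : m = 0
        · subst hm
          rw [coeff_truncTotal _ (by simp)]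
          simpa using h
        · rw [coeff_truncTotal_eq_zero _ (by
            rw [Nat.one_le_iff_ne_zero]
            exact mt (Finsupp.degree_eq_zero_iff m).1 hm), MvPolynomial.coeff_zero]
      have h2 : AdicCompletion.evalOneₐ _ (toAdicCompletion (Fin n) k f) = 0 := by
        rw [toAdicCompletion, AdicCompletion.evalOneₐ_liftAlgHom, truncTotalAlgHom_apply, h1]
        · simp
        · exact fun h => AlgHom.ext fun _ => by
            simpa [Ideal.Quotient.mk_eq_mk_iff_sub_mem] using
              truncTotal_sub_truncTotal_mem_pow_idealOfVars h le_rfl _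
      exact h2
    obtain ⟨g, hg, hge⟩ := (Ideal.mem_map_iff_of_surjective e e.surjective).1 hef
    rwa [← e.injective hge]

theorem maximalIdeal_eq_span_range_X {n : ℕ} {k : Type*} [Field k] :
    IsLocalRing.maximalIdeal (MvPowerSeries (Fin n) k) = Ideal.span (Set.range X) := by
  ext f
  rw [IsLocalRing.mem_maximalIdeal, mem_nonunits_iff, isUnit_iff_constantCoeff,
    isUnit_iff_ne_zero, not_not, mem_span_range_X_iff]

instance isAdicComplete_maximalIdeal {n : ℕ} {k : Type*} [Field k] :
    IsAdicComplete (IsLocalRing.maximalIdeal (MvPowerSeries (Fin n) k))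
      (MvPowerSeries (Fin n) k) := by
  rw [maximalIdeal_eq_span_range_X]
  infer_instance

/-- Power series rings in finitely many variables over an infinite field are factorial. -/
theorem uniqueFactorizationMonoid_fin {k : Type*} [Field k] [Infinite k] (n : ℕ) :
    UniqueFactorizationMonoid (MvPowerSeries (Fin n) k) := by
  induction n with
  | zero =>
    exact (isEmptyEquiv (σ := Fin 0) (R := k)).symm.toMulEquiv.uniqueFactorizationMonoid
      inferInstance
  | succ n ih =>
    have : IsDomain (MvPowerSeries (Fin n) k) := NoZeroDivisors.to_isDomain _
    have : IsDomain (MvPowerSeries (Fin (n + 1)) k) := NoZeroDivisors.to_isDomain _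
    -- Kaplansky's criterion: every nonzero prime ideal must contain a prime element.
    rw [UniqueFactorizationMonoid.iff_exists_prime_mem_of_isPrime]
    intro I hI0 hI
    obtain ⟨f, hfI, hf0⟩ := Submodule.exists_mem_ne_zero_of_ne_bot hI0
    obtain ⟨b, hb, d, hd⟩ := exists_shear_coeff_ne_zero hf0
    set e : MvPowerSeries (Fin (n + 1)) k ≃+* PowerSeries (MvPowerSeries (Fin n) k) :=
      (shear b hb).trans (finSuccEquiv k n).toRingEquiv
    have hJ : (I.comap e.symm).IsPrime := Ideal.comap_isPrime _ I
    have hmem : e f ∈ I.comap e.symm := by simpa [Ideal.mem_comap] using hfI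
    -- The residue of the `d`-th coefficient is the coefficient of `x₀^d`, nonzero after the shear.
    have hres : PowerSeries.map (IsLocalRing.residue _) (e f) ≠ 0 := by
      intro h
      have h1 := congrArg (PowerSeries.coeff d) h
      rw [PowerSeries.coeff_map, map_zero, IsLocalRing.residue_eq_zero_iff,
        maximalIdeal_eq_span_range_X, mem_span_range_X_iff, ← coeff_zero_eq_constantCoeff_apply]
        at h1
      refine hd ?_
      rw [← h1]
      change _ = coeff 0 (PowerSeries.coeff d (finSuccEquiv k n (shear b hb f)))
      rw [coeff_coeff_finSuccEquiv]
      congr 2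
      ext i
      refine Fin.cases ?_ (fun j => ?_) i <;> simp [Finsupp.cons_zero, Finsupp.cons_succ]
    obtain ⟨q, hq, hqp⟩ := PowerSeries.exists_prime_mem_of_map_residue_ne_zero hJ hmem hres
    exact ⟨e.symm q, hq, (MulEquiv.prime_iff e.symm).2 hqp⟩

end MvPowerSeries

/-- Krull's intersection theorem in `A ⧸ I`: ideals are `m`-adically closed. -/
theorem Ideal.mem_of_forall_exists_sub_mem_pow {A : Type*} [CommRing A] [IsNoetherianRing A]
    [IsLocalRing A] {m I : Ideal A} (hm : m ≠ ⊤) {s : A}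
    (h : ∀ k, ∃ r ∈ I, s - r ∈ m ^ k) : s ∈ I := by
  have hbot := Ideal.iInf_pow_smul_eq_bot_of_isLocalRing (M := A ⧸ I) m hm
  rw [← Ideal.Quotient.eq_zero_iff_mem, ← Submodule.mem_bot A, ← hbot, Submodule.mem_iInf]
  intro k
  obtain ⟨r, hr, hsr⟩ := h k
  have heq : Ideal.Quotient.mk I s = (s - r) • (1 : A ⧸ I) := by
    rw [Algebra.smul_def, mul_one, Ideal.Quotient.algebraMap_eq, map_sub,
      Ideal.Quotient.eq_zero_iff_mem.2 hr, sub_zero]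
  rw [heq]
  exact Submodule.smul_mem_smul hsr trivial

/-! ### The ring `T`, density of polynomials, extension and contraction of ideals -/

namespace PowerSeriesSubrings

variable {n : ℕ}

instance : IsDomain (T n) := NoZeroDivisors.to_isDomain _

instance : UniqueFactorizationMonoid (T n) := MvPowerSeries.uniqueFactorizationMonoid_fin n

instance : IsAdicComplete (M n) (T n) :=
  inferInstanceAs (IsAdicComplete (Ideal.span (Set.range MvPowerSeries.X)) (T n))

theorem mem_M_iff {t : T n} : t ∈ M n ↔ MvPowerSeries.constantCoeff t = 0 :=
  MvPowerSeries.mem_span_range_X_iff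

theorem isUnit_iff_notMem_M {t : T n} : IsUnit t ↔ t ∉ M n := by
  rw [mem_M_iff, MvPowerSeries.isUnit_iff_constantCoeff, isUnit_iff_ne_zero]

theorem X_ne_zero (i : Fin n) : (MvPowerSeries.X i : T n) ≠ 0 := fun h => by
  simpa using congrArg (MvPowerSeries.coeff (Finsupp.single i 1)) h

theorem X_mem_R₀ (i : Fin n) : (MvPowerSeries.X i : T n) ∈ R₀ n :=
  ⟨MvPolynomial.X i, MvPolynomial.coe_X i⟩

theorem C_mem_R₀ (q : ℚ) : (MvPowerSeries.C q : T n) ∈ R₀ n :=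
  ⟨MvPolynomial.C q, MvPolynomial.coe_C q⟩

theorem exists_mem_R₀_sub_mem_M_pow (k : ℕ) (t : T n) : ∃ a ∈ R₀ n, t - a ∈ M n ^ k := by
  induction k generalizing t with
  | zero => exact ⟨0, zero_mem _, by simp⟩
  | succ k ih =>
    have h : t - MvPowerSeries.C (MvPowerSeries.constantCoeff t) ∈ M n := by
      simp [mem_M_iff]
    obtain ⟨c, hc⟩ := Ideal.mem_span_range_iff_exists_fun.1 h
    choose a ha hca using fun i => ih (c i)
    refine ⟨MvPowerSeries.C (MvPowerSeries.constantCoeff t) + ∑ i, a i * MvPowerSeries.X i,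
      add_mem (C_mem_R₀ _) (sum_mem fun i _ => mul_mem (ha i) (X_mem_R₀ i)), ?_⟩
    rw [← sub_sub, ← hc, ← Finset.sum_sub_distrib]
    refine sum_mem fun i _ => ?_
    rw [← sub_mul, pow_succ]
    exact Ideal.mul_mem_mul (hca i) (Ideal.subset_span ⟨i, rfl⟩)

theorem mem_extend_of_mem {R : Subring (T n)} {I : Ideal R} {r : R} (hr : r ∈ I) :
    (r : T n) ∈ extend R I :=
  Ideal.mem_map_of_mem R.subtype hr

theorem mem_contract {R : Subring (T n)} {J : Ideal (T n)} {r : R} :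
    r ∈ contract R J ↔ (r : T n) ∈ J := Iff.rfl

theorem le_contract_extend (R : Subring (T n)) (I : Ideal R) : I ≤ contract R (extend R I) :=
  Ideal.le_comap_map

/-- The variable `xᵢ` as an element of a subring containing the polynomials. -/
noncomputable def var {R : Subring (T n)} (hR : R₀ n ≤ R) (i : Fin n) : R :=
  ⟨MvPowerSeries.X i, hR (X_mem_R₀ i)⟩

theorem extend_span_range_var {R : Subring (T n)} (hR : R₀ n ≤ R) :
    extend R (Ideal.span (Set.range (var hR))) = M n := by
  rw [extend, Ideal.map_span, ← Set.range_comp]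
  rfl

theorem extend_interM {R : Subring (T n)} (hR : R₀ n ≤ R) : extend R (interM R) = M n := by
  refine le_antisymm Ideal.map_comap_le ?_
  rw [← extend_span_range_var hR]
  refine Ideal.map_mono ?_
  rw [Ideal.span_le]
  rintro _ ⟨i, rfl⟩
  exact Ideal.subset_span ⟨i, rfl⟩

theorem extend_interM_pow {R : Subring (T n)} (hR : R₀ n ≤ R) (k : ℕ) :
    extend R (interM R ^ k) = M n ^ k := by
  rw [extend, Ideal.map_pow]
  exact congrArg (· ^ k) (extend_interM hR)

/-! ### Ideals of subrings with completion `T` -/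

/-- The inverse isomorphism yields an `R`-algebra map from `T` to `R ⧸ interM R ^ k`. It kills
`M^k`, which is extended from `interM R ^ k`. -/
theorem contract_M_pow_le_of_hasCompletion {R : Subring (T n)} (hR : R₀ n ≤ R)
    (hc : HasCompletionT R) (k : ℕ) : contract R (M n ^ k) ≤ interM R ^ k := by
  obtain ⟨e⟩ := hc
  intro s hs
  rw [mem_contract, ← extend_interM_pow hR] at hs
  set g : T n →ₐ[R] R ⧸ interM R ^ k :=
    (AdicCompletion.evalₐ (interM R) k).comp (e.symm : T n →ₐ[R] AdicCompletion (interM R) R)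
  have hle : extend R (interM R ^ k) ≤ RingHom.ker g.toRingHom := by
    refine Ideal.map_le_iff_le_comap.2 fun r hr => ?_
    change g (algebraMap R (T n) r) = 0
    rw [g.commutes]
    exact Ideal.Quotient.eq_zero_iff_mem.2 hr
  have h0 : g (algebraMap R (T n) s) = 0 := hle hs
  rw [g.commutes] at h0
  exact Ideal.Quotient.eq_zero_iff_mem.1 h0

/-- Coefficients from `T` can be replaced by polynomials modulo `M^k`. -/
theorem exists_mem_sub_mem_M_pow_of_mem_extend {R : Subring (T n)} (hR : R₀ n ≤ R) {I : Ideal R}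
    {t : T n} (ht : t ∈ extend R I) (k : ℕ) : ∃ r ∈ I, t - r ∈ M n ^ k := by
  refine Submodule.span_induction (p := fun t _ => ∃ r ∈ I, t - (r : T n) ∈ M n ^ k)
    ?_ ?_ ?_ ?_ ht
  · rintro _ ⟨r, hr, rfl⟩
    exact ⟨r, hr, by simp⟩
  · exact ⟨0, zero_mem _, by simp⟩
  · rintro x y - - ⟨r, hr, hxr⟩ ⟨s, hs, hys⟩
    refine ⟨r + s, add_mem hr hs, ?_⟩
    rw [Subring.coe_add, add_sub_add_comm]
    exact add_mem hxr hys
  · rintro c x - ⟨r, hr, hxr⟩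
    obtain ⟨a, ha, hca⟩ := exists_mem_R₀_sub_mem_M_pow k c
    refine ⟨⟨a, hR ha⟩ * r, I.mul_mem_left _ hr, ?_⟩
    have : c • x - ((⟨a, hR ha⟩ * r : R) : T n) = c * (x - r) + (c - a) * r := by
      rw [Subring.coe_mul, smul_eq_mul]
      ring
    rw [this]
    exact add_mem (Ideal.mul_mem_left _ _ hxr) (Ideal.mul_mem_right _ _ hca)

theorem contract_extend_of_hasCompletion {R : Subring (T n)} (hR : R₀ n ≤ R)
    (hl : IsQuasiLocal R) [IsNoetherianRing R] (hc : HasCompletionT R) (I : Ideal R) :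
    contract R (extend R I) = I := by
  refine le_antisymm (fun s hs => ?_) (le_contract_extend R I)
  have := hl.1
  refine Ideal.mem_of_forall_exists_sub_mem_pow hl.2.ne_top fun k => ?_
  obtain ⟨r, hr, hsr⟩ := exists_mem_sub_mem_M_pow_of_mem_extend hR hs k
  exact ⟨r, hr, contract_M_pow_le_of_hasCompletion hR hc k hsr⟩

/-! ### Subrings all of whose finitely generated ideals are contracted -/

section Closed

variable {R : Subring (T n)}

/-- Finitely many elements of `I` generate `IT`; contracting the ideal they generate gives back `I`.
-/
theorem isNoetherianRing_of_contract_extend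
    (h : ∀ I : Ideal R, I.FG → contract R (extend R I) = I) : IsNoetherianRing R := by
  rw [isNoetherianRing_iff_ideal_fg]
  intro I
  have hfg : (Ideal.span (R.subtype '' (I : Set R))).FG := IsNoetherian.noetherian _
  obtain ⟨s, hs, hspan⟩ := (Submodule.fg_span_iff_fg_span_finset_subset _).1 hfg
  classical
  obtain ⟨G, hG, rfl⟩ := Finset.subset_set_image_iff.1 hs
  have hle : Ideal.span (G : Set R) ≤ I := Ideal.span_le.2 hG
  have hGI : I = Ideal.span (G : Set R) := by
    refine le_antisymm (fun r hr => ?_) hle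
    rw [← h _ ⟨G, rfl⟩, mem_contract]
    have h1 : (r : T n) ∈ Ideal.span (R.subtype '' (I : Set R)) := mem_extend_of_mem hr
    have h2 : (r : T n) ∈ Ideal.span ((G.image R.subtype : Finset (T n)) : Set (T n)) := by
      rw [Ideal.span, ← hspan]
      exact h1
    rwa [Finset.coe_image, ← Ideal.map_span] at h2
  exact ⟨G, hGI.symm⟩

theorem interM_eq_span_range_var (hR : R₀ n ≤ R)
    (h : ∀ I : Ideal R, I.FG → contract R (extend R I) = I) :
    interM R = Ideal.span (Set.range (var hR)) := by
  rw [← h (Ideal.span (Set.range (var hR))) (Submodule.fg_span (Set.finite_range _)),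
    extend_span_range_var]
  rfl

theorem contract_M_pow (hR : R₀ n ≤ R)
    (h : ∀ I : Ideal R, I.FG → contract R (extend R I) = I) (k : ℕ) :
    contract R (M n ^ k) = interM R ^ k := by
  have := isNoetherianRing_of_contract_extend h
  rw [← extend_interM_pow hR]
  exact h _ (IsNoetherian.noetherian _)

/-- Each map `R/(R ∩ M)^k → T/M^k` is bijective: injective by contraction, surjective by density.
The inverses assemble into a map from `T` to the completion, bijective since `T` is `M`-adically
complete. -/
theorem hasCompletionT_of_contract_extend (hR : R₀ n ≤ R)
    (h : ∀ I : Ideal R, I.FG → contract R (extend R I) = I) : HasCompletionT R := by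
  have hcomap : ∀ k, interM R ^ k = (M n ^ k).comap (Algebra.ofId R (T n)) :=
    fun k => (contract_M_pow hR h k).symm
  set φ : ∀ k, (R ⧸ interM R ^ k) →ₐ[R] (T n ⧸ M n ^ k) := fun k =>
    Ideal.quotientMapₐ (M n ^ k) (Algebra.ofId R (T n)) (hcomap k).le
  have hφmk : ∀ k (r : R), φ k (Ideal.Quotient.mk _ r) = Ideal.Quotient.mk _ (r : T n) :=
    fun k r => rfl
  have hinj : ∀ k, Function.Injective (φ k) := fun k =>
    Ideal.quotientMap_injective' (f := (Algebra.ofId R (T n)).toRingHom) (H := (hcomap k).le)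
      (hcomap k).ge
  have hsurj : ∀ k, Function.Surjective (φ k) := by
    intro k y
    obtain ⟨t, rfl⟩ := Ideal.Quotient.mk_surjective y
    obtain ⟨a, ha, hta⟩ := exists_mem_R₀_sub_mem_M_pow k t
    exact ⟨Ideal.Quotient.mk _ ⟨a, hR ha⟩, ((Ideal.Quotient.eq).2 hta).symm⟩
  set ψ : ∀ k, T n →ₐ[R] R ⧸ interM R ^ k := fun k =>
    ((AlgEquiv.ofBijective (φ k) ⟨hinj k, hsurj k⟩).symm : _ →ₐ[R] _).comp
      (Ideal.Quotient.mkₐ R (M n ^ k))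
  have hφψ : ∀ k (t : T n), φ k (ψ k t) = Ideal.Quotient.mk (M n ^ k) t := fun k t =>
    (AlgEquiv.ofBijective (φ k) ⟨hinj k, hsurj k⟩).apply_symm_apply _
  have hψ : ∀ k (t : T n) (r : R), t - (r : T n) ∈ M n ^ k → ψ k t = Ideal.Quotient.mk _ r := by
    intro k t r htr
    apply hinj k
    rw [hφψ, hφmk]
    exact (Ideal.Quotient.eq).2 htr
  have hcompat : ∀ {m l : ℕ} (hle : m ≤ l),
      (Ideal.Quotient.factorₐ R (Ideal.pow_le_pow_right hle)).comp (ψ l) = ψ m := by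
    intro m l hle
    refine AlgHom.ext fun t => ?_
    obtain ⟨a, ha, hta⟩ := exists_mem_R₀_sub_mem_M_pow l t
    rw [AlgHom.comp_apply, hψ l t ⟨a, hR ha⟩ hta,
      hψ m t ⟨a, hR ha⟩ (Ideal.pow_le_pow_right hle hta)]
    rfl
  refine ⟨(AlgEquiv.ofBijective (AdicCompletion.liftAlgHom (interM R) ψ hcompat) ⟨?_, ?_⟩).symm⟩
  · rw [injective_iff_map_eq_zero]
    intro t ht
    refine IsHausdorff.haus' (I := M n) t fun k => ?_
    rw [SModEq.zero, smul_eq_mul, Ideal.mul_top, ← Ideal.Quotient.eq_zero_iff_mem, ← hφψ,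
      ← AdicCompletion.evalₐ_liftAlgHom (interM R) ψ hcompat, ht, map_zero, map_zero]
  · intro x
    obtain ⟨r, rfl⟩ := AdicCompletion.mk_surjective (interM R) R x
    obtain ⟨L, hL⟩ := IsPrecomplete.prec' (I := M n) (fun k => (r k : T n)) (by
      intro m l hle
      have := r.2 hle
      rw [SModEq.sub_mem, smul_eq_mul, Ideal.mul_top] at this ⊢
      exact (contract_M_pow hR h m).ge this)
    refine ⟨L, AdicCompletion.ext_evalₐ fun k => ?_⟩
    rw [AdicCompletion.evalₐ_liftAlgHom, AdicCompletion.evalₐ_mk]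
    refine hψ k L (r k) ?_
    have := hL k
    rw [SModEq.sub_mem, smul_eq_mul, Ideal.mul_top] at this
    rw [← neg_sub]
    exact neg_mem this

/-! ### Coordinate primes, dimension and regularity -/

/-- Setting the variables `xᵢ` with `i < k` equal to zero. -/
noncomputable def truncVars (n k : ℕ) : Fin n → T n :=
  fun i => if (i : ℕ) < k then 0 else MvPowerSeries.X i

theorem hasSubst_truncVars (n k : ℕ) : MvPowerSeries.HasSubst (truncVars n k) := by
  refine MvPowerSeries.hasSubst_of_constantCoeff_zero fun i => ?_
  by_cases h : (i : ℕ) < k <;> simp [truncVars, h]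

/-- The prime ideal generated by the variables `xᵢ` with `i < k`. -/
noncomputable def varsPrime (n k : ℕ) : Ideal (T n) :=
  RingHom.ker (MvPowerSeries.substAlgHom (R := ℚ) (hasSubst_truncVars n k)).toRingHom

theorem mem_varsPrime {k : ℕ} {t : T n} :
    t ∈ varsPrime n k ↔ MvPowerSeries.subst (truncVars n k) t = 0 := by
  rw [← MvPowerSeries.coe_substAlgHom (hasSubst_truncVars n k)]
  rfl

instance (k : ℕ) : (varsPrime n k).IsPrime := RingHom.ker_isPrime _

theorem X_mem_varsPrime_iff {k : ℕ} {i : Fin n} :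
    (MvPowerSeries.X i : T n) ∈ varsPrime n k ↔ (i : ℕ) < k := by
  rw [mem_varsPrime, MvPowerSeries.subst_X (hasSubst_truncVars n k)]
  by_cases h : (i : ℕ) < k
  · simp [truncVars, h]
  · simp [truncVars, h, X_ne_zero]

theorem varsPrime_mono {k l : ℕ} (h : k ≤ l) : varsPrime n k ≤ varsPrime n l := by
  intro t ht
  rw [mem_varsPrime] at ht ⊢
  have key : (fun s => MvPowerSeries.subst (truncVars n l) (truncVars n k s)) = truncVars n l := by
    funext i
    by_cases hi : (i : ℕ) < k
    · rw [truncVars, if_pos hi, ← MvPowerSeries.coe_substAlgHom (hasSubst_truncVars n l), map_zero,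
        truncVars, if_pos (hi.trans_le h)]
    · rw [truncVars, if_neg hi, MvPowerSeries.subst_X (hasSubst_truncVars n l)]
  rw [← key, ← MvPowerSeries.subst_comp_subst_apply (hasSubst_truncVars n k)
    (hasSubst_truncVars n l), ht, ← MvPowerSeries.coe_substAlgHom (hasSubst_truncVars n l),
    map_zero]

/-- The `n + 1` coordinate primes remain distinct after contraction, because the variables that
separate them lie in `R`. -/
theorem le_ringKrullDim (hR : R₀ n ≤ R) : (n : WithBot ℕ∞) ≤ ringKrullDim R := by
  set f : Fin (n + 1) → PrimeSpectrum R := fun k =>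
    ⟨contract R (varsPrime n k), Ideal.comap_isPrime _ _⟩
  have hf : StrictMono f := by
    intro k l hkl
    refine lt_of_le_of_ne (fun r hr => varsPrime_mono (Fin.le_def.1 hkl.le) hr) fun heq => ?_
    have hk : (k : ℕ) < n := by omega
    have h2 : contract R (varsPrime n k) = contract R (varsPrime n l) :=
      congrArg PrimeSpectrum.asIdeal heq
    have h1 : var hR ⟨k, hk⟩ ∈ contract R (varsPrime n l) :=
      (X_mem_varsPrime_iff (i := ⟨k, hk⟩)).2 (Fin.lt_def.1 hkl)
    rw [← h2] at h1
    exact lt_irrefl _ ((X_mem_varsPrime_iff (i := ⟨k, hk⟩)).1 h1)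
  exact Order.LTSeries.length_le_krullDim (LTSeries.mk n f hf)

/-- The `n` variables generate the maximal ideal, and the dimension is at least `n`. -/
theorem isRegularLocalRing_of_contract_extend (hR : R₀ n ≤ R) (hl : IsQuasiLocal R)
    (h : ∀ I : Ideal R, I.FG → contract R (extend R I) = I) : IsRegularLocalRing R := by
  have := hl.1
  have := isNoetherianRing_of_contract_extend h
  refine IsRegularLocalRing.of_spanFinrank_maximalIdeal_le R (le_trans ?_ (le_ringKrullDim hR))
  rw [← IsLocalRing.eq_maximalIdeal hl.2, interM_eq_span_range_var hR h]
  have h1 := Submodule.spanFinrank_span_le_ncard_of_finite (R := R) (Set.finite_range (var hR))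
  have h2 : (Set.range (var hR)).ncard ≤ n := by
    rw [← Set.image_univ]
    exact (Set.ncard_image_le Set.finite_univ).trans (by simp [Set.ncard_univ])
  exact_mod_cast h1.trans h2

end Closed

end PowerSeriesSubrings

/-- The closure of a countable set under countably many finitary operations is countable. -/
theorem Set.Countable.exists_countable_closed {α : Type*} {A : Set α} (hA : A.Countable)
    {F : Finset α → Set α} (hF : ∀ G, (F G).Countable) :
    ∃ S : Set α, S.Countable ∧ A ⊆ S ∧ ∀ G : Finset α, (G : Set α) ⊆ S → F G ⊆ S := by
  set next : Set α → Set α := fun B => B ∪ ⋃ G ∈ {G : Finset α | (G : Set α) ⊆ B}, F G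
  set B : ℕ → Set α := fun k => next^[k] A
  have hB : ∀ k, B (k + 1) = next (B k) := fun k => Function.iterate_succ_apply' next k A
  have hcount : ∀ k, (B k).Countable := by
    intro k
    induction k with
    | zero => exact hA
    | succ k ih =>
      rw [hB]
      refine ih.union (Set.Countable.biUnion ?_ fun G _ => hF G)
      have h1 := Set.countable_ofPred_finite_subset ih
      refine Set.Countable.mono (fun G hG => ?_)
        (h1.preimage_of_injOn (f := fun G : Finset α => (G : Set α)) Finset.coe_injective.injOn)
      exact ⟨G.finite_toSet, hG⟩
  have hmono : Monotone B := monotone_nat_of_le_succ fun k => by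
    rw [hB]
    exact Set.subset_union_left
  refine ⟨⋃ k, B k, Set.countable_iUnion hcount, Set.subset_iUnion B 0, fun G hG => ?_⟩
  -- A finite set lies in a single stage, so `F G` lies in the next one.
  obtain ⟨k, hk⟩ := Directed.exists_mem_subset_of_finset_subset_biUnion hmono.directed_le hG
  refine Set.Subset.trans ?_ (Set.subset_iUnion B (k + 1))
  rw [hB]
  have hmem : G ∈ {G : Finset α | (G : Set α) ⊆ B k} := hk
  exact (Set.subset_biUnion_of_mem (u := F) hmem).trans Set.subset_union_right

namespace PowerSeriesSubrings

variable {n : ℕ}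

theorem isQuasiLocal_of_inv_mem {R : Subring (T n)}
    (h : ∀ r ∈ R, r ∉ M n → ∃ s ∈ R, r * s = 1) : IsQuasiLocal R := by
  have hunit : ∀ r : R, r ∉ interM R → IsUnit r := by
    intro r hr
    obtain ⟨s, hs, hrs⟩ := h r r.2 hr
    exact IsUnit.of_mul_eq_one ⟨s, hs⟩ (Subtype.ext hrs)
  have h1 : (1 : R) ∉ interM R := by
    intro h1
    have : (1 : T n) ∈ M n := h1
    simp [mem_M_iff] at this
  refine ⟨IsLocalRing.of_isUnit_or_isUnit_one_sub_self fun a => ?_, ?_⟩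
  · by_cases ha : a ∈ interM R
    · refine Or.inr (hunit _ fun ha' => h1 ?_)
      simpa using add_mem ha' ha
    · exact Or.inl (hunit a ha)
  · rw [Ideal.isMaximal_iff]
    exact ⟨h1, fun J x _ hx hxJ => (Ideal.eq_top_of_isUnit_mem J hxJ (hunit x hx)) ▸ trivial⟩

/-! ### Existence of base rings -/

open Classical in
/-- Coefficients of an expression of `c` as a linear combination of elements of `G`, if any. -/
noncomputable def linCoeff (G : Finset (T n)) (c : T n) : T n → T n :=
  if h : ∃ g : T n → T n, ∑ a ∈ G, g a * a = c then h.choose else 0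

theorem sum_linCoeff_mul {G : Finset (T n)} {c : T n}
    (h : c ∈ Ideal.span (G : Set (T n))) : ∑ a ∈ G, linCoeff G c a * a = c := by
  obtain ⟨g, -, hg⟩ := Submodule.mem_span_finset.1 h
  have h' : ∃ g : T n → T n, ∑ a ∈ G, g a * a = c := ⟨g, hg⟩
  rw [linCoeff, dif_pos h']
  exact h'.choose_spec

/-- The elements that a base ring containing `G` should contain. -/
noncomputable def baseOps (G : Finset (T n)) : Set (T n) :=
  {0, 1} ∪ (⋃ a ∈ G, {-a, a⁻¹}) ∪ (⋃ a ∈ G, ⋃ b ∈ G, {a + b, a * b}) ∪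
    (⋃ c ∈ G, {p | p ∈ UniqueFactorizationMonoid.factors c}) ∪
    ⋃ c ∈ G, ⋃ H ∈ G.powerset, linCoeff H c '' (H : Set (T n))

theorem countable_baseOps (G : Finset (T n)) : (baseOps G).Countable := by
  classical
  have hG := G.countable_toSet
  refine ((((Set.toFinite _).countable.union ?_).union ?_).union ?_).union ?_
  · exact hG.biUnion fun a _ => (Set.toFinite _).countable
  · exact hG.biUnion fun a _ => hG.biUnion fun b _ => (Set.toFinite _).countable
  · refine hG.biUnion fun c _ => ?_
    have : {p | p ∈ UniqueFactorizationMonoid.factors c} =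
        ((UniqueFactorizationMonoid.factors c).toFinset : Set (T n)) := by
      ext p
      simp
    rw [this]
    exact Finset.countable_toSet _
  · exact hG.biUnion fun c _ => G.powerset.countable_toSet.biUnion fun H _ =>
      H.countable_toSet.image _

theorem exists_isBaseRing (n : ℕ) : ∃ S : Subring (T n), IsBaseRing S := by
  classical
  have hR₀ : (R₀ n : Set (T n)).Countable := by
    have : Countable (MvPolynomial (Fin n) ℚ) := by
      rw [← Cardinal.mk_le_aleph0_iff]
      exact MvPolynomial.cardinalMk_le_max.trans (by simp)
    rw [R₀, RingHom.coe_range]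
    exact Set.countable_range _
  obtain ⟨A, hA, hRA, hF⟩ := hR₀.exists_countable_closed (F := baseOps) countable_baseOps
  have hsub : ∀ {G : Finset (T n)}, (∀ a ∈ G, a ∈ A) → ∀ {t}, t ∈ baseOps G → t ∈ A :=
    fun {G} hG t ht => hF G hG ht
  have hadd : ∀ {a b}, a ∈ A → b ∈ A → a + b ∈ A := fun {a b} ha hb =>
    hsub (G := {a, b}) (by simp [ha, hb]) (by simp [baseOps])
  have hmul : ∀ {a b}, a ∈ A → b ∈ A → a * b ∈ A := fun {a b} ha hb =>
    hsub (G := {a, b}) (by simp [ha, hb]) (by simp [baseOps])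
  have hneg : ∀ {a}, a ∈ A → -a ∈ A := fun {a} ha =>
    hsub (G := {a}) (by simp [ha]) (by simp [baseOps])
  -- The inverse of a nonunit is 0 by convention, so closing under inverses is harmless.
  have hinv : ∀ {a}, a ∈ A → a⁻¹ ∈ A := fun {a} ha =>
    hsub (G := {a}) (by simp [ha]) (by simp [baseOps])
  have hzero : (0 : T n) ∈ A := hsub (G := ∅) (by simp) (by simp [baseOps])
  have hone : (1 : T n) ∈ A := hsub (G := ∅) (by simp) (by simp [baseOps])
  have hfac : ∀ {a p}, a ∈ A → p ∈ UniqueFactorizationMonoid.factors a → p ∈ A :=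
    fun {a p} ha hp => hsub (G := {a}) (by simp [ha]) (by simp [baseOps, hp])
  have hlin : ∀ {H : Finset (T n)} {c a}, (H : Set (T n)) ⊆ A → c ∈ A → a ∈ H →
      linCoeff H c a ∈ A := by
    intro H c a hH hc ha
    refine hsub (G := insert c H) (fun b hb => ?_) (Or.inr ?_)
    · rcases Finset.mem_insert.1 hb with rfl | hb
      exacts [hc, hH hb]
    · simp only [Set.mem_iUnion]
      exact ⟨c, Finset.mem_insert_self _ _, H,
        Finset.mem_powerset.2 (Finset.subset_insert _ _), a, ha, rfl⟩
  set S : Subring (T n) :=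
    { carrier := A, mul_mem' := hmul, one_mem' := hone, add_mem' := hadd, zero_mem' := hzero,
      neg_mem' := hneg }
  have hS : R₀ n ≤ S := hRA
  have hl : IsQuasiLocal S := isQuasiLocal_of_inv_mem fun r hr hrM =>
    ⟨r⁻¹, hinv hr, MvPowerSeries.mul_inv_cancel r (mt mem_M_iff.2 hrM)⟩
  -- A linear relation over `T` between elements of `S` is replaced by the selected one, whose
  -- coefficients lie in `S`.
  have hclosed : ∀ I : Ideal S, I.FG → contract S (extend S I) = I := by
    rintro _ ⟨G, rfl⟩
    refine le_antisymm (fun c hc => ?_) (le_contract_extend _ _)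
    have hc' : (c : T n) ∈ Ideal.span ((G.image S.subtype : Finset (T n)) : Set (T n)) := by
      rw [Finset.coe_image, ← Ideal.map_span]
      exact hc
    have hGA : ((G.image S.subtype : Finset (T n)) : Set (T n)) ⊆ A := by
      rw [Finset.coe_image]
      rintro _ ⟨g, -, rfl⟩
      exact g.2
    have hsum := sum_linCoeff_mul hc'
    rw [Finset.sum_image (s := G) (g := S.subtype) (fun x _ y _ h => Subtype.ext h)] at hsum
    have hcS : c = ∑ g ∈ G.attach, (⟨linCoeff (G.image S.subtype) c (g : S),
        hlin hGA c.2 (Finset.mem_image_of_mem S.subtype g.2)⟩ : S) * (g : S) := by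
      apply Subtype.ext
      refine hsum.symm.trans ?_
      rw [← Finset.sum_attach, AddSubmonoidClass.coe_finsetSum]
      rfl
    rw [hcS]
    exact sum_mem fun g _ => Ideal.mul_mem_left _ _ (Ideal.subset_span g.2)
  refine ⟨S, hA, hS, hl, isRegularLocalRing_of_contract_extend hS hl hclosed,
    hasCompletionT_of_contract_extend hS hclosed, ?_⟩
  intro r hr hr0 p hp hrp
  obtain ⟨q, hq, u, hu⟩ := UniqueFactorizationMonoid.exists_mem_factors_of_dvd hr0 hp.irreducible
    (Ideal.mem_span_singleton.1 hrp)
  exact ⟨u, u.isUnit, hu ▸ hfac hr hq⟩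

end PowerSeriesSubrings

namespace PowerSeriesSubrings

variable {n : ℕ}

/-! ### Existence of final rings -/

theorem exists_eval_add_mul_ne_zero {A : Type*} [CommRing A] [IsDomain A] [Infinite A]
    {f : Polynomial A} (hf : f ≠ 0) (a : A) {d : A} (hd : d ≠ 0) :
    ∃ c, f.eval (a + d * c) ≠ 0 := by
  by_contra! h
  refine hf (Polynomial.eq_zero_of_infinite_isRoot f ?_)
  refine (Set.infinite_range_of_injective (f := fun c : A => a + d * c) ?_).mono ?_
  · intro c c' hcc
    exact mul_left_cancel₀ hd (add_left_cancel hcc)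
  · rintro _ ⟨c, rfl⟩
    exact h c

/-- Approximations to an element at which all the polynomials `f j` take values that are, up to a
unit, already taken in the subring. -/
theorem exists_approximations {A : Type*} [CommRing A] [IsDomain A] [Infinite A] {x : A}
    (hx : x ≠ 0) (f : ℕ → Polynomial A) (hf : ∀ j, f j ≠ 0) :
    ∃ a d : ℕ → A, ∀ j, x ^ j ∣ d j ∧ d j ∣ d (j + 1) ∧ d j * x ∣ a (j + 1) - a j ∧
      (f j).eval (a (j + 1)) ≠ 0 ∧ (f j).eval (a (j + 1)) ∣ d (j + 1) := by
  -- The new `a` avoids the roots of `f j`, and its value there becomes a factor of the new `d`.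
  -- Later corrections are multiples of `d * x`, so they change this value only by a multiple of `x`
  -- times itself.
  have step : ∀ (j : ℕ) (p : {p : A × A // p.2 ≠ 0}), ∃ q : {p : A × A // p.2 ≠ 0},
      p.1.2 * x ∣ q.1.2 ∧ p.1.2 * x ∣ q.1.1 - p.1.1 ∧
      (f j).eval q.1.1 ≠ 0 ∧ (f j).eval q.1.1 ∣ q.1.2 := by
    rintro j ⟨⟨a, d⟩, hd⟩
    obtain ⟨c, hc⟩ := exists_eval_add_mul_ne_zero (hf j) a (mul_ne_zero hd hx)
    refine ⟨⟨⟨a + d * x * c, d * x * (f j).eval (a + d * x * c)⟩,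
      mul_ne_zero (mul_ne_zero hd hx) hc⟩, Dvd.intro _ rfl, ⟨c, ?_⟩, hc, Dvd.intro_left _ rfl⟩
    simp
  choose next hnext using step
  set p : ℕ → {p : A × A // p.2 ≠ 0} := fun j => Nat.rec ⟨(0, 1), one_ne_zero⟩ next j
  have hp : ∀ j, p (j + 1) = next j (p j) := fun j => rfl
  refine ⟨fun j => (p j).1.1, fun j => (p j).1.2, fun j => ?_⟩
  obtain ⟨h1, h2, h3, h4⟩ := hnext j (p j)
  rw [← hp] at h1 h2 h3 h4
  refine ⟨?_, (Dvd.intro x rfl).trans h1, h2, h3, h4⟩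
  clear h1 h2 h3 h4
  induction j with
  | zero => simp
  | succ j ih =>
    rw [pow_succ]
    refine (mul_dvd_mul_right ih x).trans ?_
    exact (hnext j (p j)).1

/-- As `x ^ j ∣ d j`, the sequence `a` converges `M`-adically; the divisibilities survive in the
limit because principal ideals are closed. -/
theorem exists_limit {x : T n} (hx : x ∈ M n) (a d : ℕ → T n)
    (h : ∀ j, x ^ j ∣ d j ∧ d j ∣ d (j + 1) ∧ d j * x ∣ a (j + 1) - a j) :
    ∃ τ, ∀ j, d j * x ∣ τ - a j := by
  have hd : ∀ {i j}, i ≤ j → d i ∣ d j := fun {i j} hij =>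
    Nat.le_induction (dvd_refl _) (fun k _ hk => hk.trans (h k).2.1) j hij
  have ha : ∀ {i j}, i ≤ j → d i * x ∣ a j - a i := by
    intro i j hij
    induction j, hij using Nat.le_induction with
    | base => simp
    | succ k hk ih =>
      rw [← sub_add_sub_cancel (a (k + 1)) (a k) (a i)]
      exact dvd_add ((mul_dvd_mul_right (hd hk) x).trans (h k).2.2) ih
  have hxM : ∀ {j k : ℕ} {t : T n}, k ≤ j → d j ∣ t → t ∈ M n ^ k := fun {j k t} hkj ht =>
    Ideal.mem_of_dvd _ (((pow_dvd_pow x hkj).trans (h j).1).trans ht) (Ideal.pow_mem_pow hx k)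
  obtain ⟨τ, hτ⟩ := IsPrecomplete.prec' (I := M n) a (by
    intro k j hkj
    rw [SModEq.sub_mem, smul_eq_mul, Ideal.mul_top, ← neg_sub]
    exact neg_mem (hxM le_rfl ((Dvd.intro x rfl).trans (ha hkj))))
  refine ⟨τ, fun j => ?_⟩
  rw [← Ideal.mem_span_singleton]
  have hM : M n ≠ ⊤ := by
    rw [Ideal.ne_top_iff_one, mem_M_iff]
    simp
  refine Ideal.mem_of_forall_exists_sub_mem_pow hM fun k => ?_
  refine ⟨a (max j k) - a j, Ideal.mem_span_singleton.2 (ha (le_max_left _ _)), ?_⟩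
  have h1 := hτ (max j k)
  rw [SModEq.sub_mem, smul_eq_mul, Ideal.mul_top] at h1
  rw [sub_sub_sub_cancel_right, ← neg_sub]
  exact neg_mem (Ideal.pow_le_pow_right (le_max_right _ _) h1)

/-- Enumerate the nonzero polynomials over the countable ring `R` and take the limit `τ` of the
approximations. With `a` the approximation chosen for `f`, one gets `f(τ) = f(a)(1 + xc)` with `f(a)
≠ 0`, and `1 + xc` is a unit. The case `f = X - r` shows `τ ∉ R`. -/
theorem exists_transcendental_aeval_associated {R : Subring (T n)} (hR : R₀ n ≤ R) (hn : 0 < n)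
    (hc : (R : Set (T n)).Countable) :
    ∃ τ ∉ R, ∀ f : Polynomial R, ∃ r : R, Associated (r : T n) (Polynomial.aeval τ f) := by
  have : Countable R := hc.to_subtype
  have : Countable (Polynomial R) := by
    rw [← Cardinal.mk_le_aleph0_iff]
    exact Polynomial.cardinalMk_le_max.trans (by simp)
  have : Infinite R := by
    refine Infinite.of_injective (fun q : ℚ => (⟨MvPowerSeries.C q, hR (C_mem_R₀ q)⟩ : R))
      fun p q hpq => ?_
    simpa using congrArg MvPowerSeries.constantCoeff (congrArg Subtype.val hpq)
  have : Nonempty {f : Polynomial R // f ≠ 0} := ⟨⟨1, one_ne_zero⟩⟩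
  obtain ⟨e, he⟩ := exists_surjective_nat {f : Polynomial R // f ≠ 0}
  set x : R := var hR ⟨0, hn⟩
  have hx0 : x ≠ 0 := fun h => X_ne_zero ⟨0, hn⟩ (congrArg Subtype.val h)
  have hxM : (x : T n) ∈ M n := Ideal.subset_span ⟨_, rfl⟩
  obtain ⟨a, d, h⟩ := exists_approximations hx0 (fun j => (e j).1) fun j => (e j).2
  have hdvd : ∀ {r s : R}, r ∣ s → (r : T n) ∣ s := fun {r s} hrs => map_dvd R.subtype hrs
  obtain ⟨τ, hτ⟩ := exists_limit hxM (fun j => (a j : T n)) (fun j => (d j : T n)) fun j =>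
    ⟨by simpa using hdvd (h j).1, hdvd (h j).2.1, by simpa using hdvd (h j).2.2.1⟩
  have key : ∀ f : Polynomial R, f ≠ 0 → ∃ r : R, r ≠ 0 ∧
      Associated (r : T n) (Polynomial.aeval τ f) := by
    intro f hf
    obtain ⟨j, hj⟩ := he ⟨f, hf⟩
    obtain ⟨-, -, -, h1, h2⟩ := h j
    rw [hj] at h1 h2
    refine ⟨f.eval (a (j + 1)), h1, ?_⟩
    have h3 : ((f.eval (a (j + 1)) : R) : T n) = Polynomial.aeval (a (j + 1) : T n) f :=
      (Polynomial.aeval_algebraMap_apply_eq_algebraMap_eval (A := T n) (a (j + 1)) f).symm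
    have h4 : τ - a (j + 1) ∣ Polynomial.aeval τ f - ((f.eval (a (j + 1)) : R) : T n) := by
      rw [h3, Polynomial.aeval_def, Polynomial.aeval_def, Polynomial.eval₂_eq_eval_map,
        Polynomial.eval₂_eq_eval_map]
      exact Polynomial.sub_dvd_eval_sub _ _ _
    obtain ⟨c, hc⟩ := ((mul_dvd_mul_right (hdvd h2) (x : T n)).trans (hτ (j + 1))).trans h4
    have hu : IsUnit (1 + (x : T n) * c) := by
      rw [isUnit_iff_notMem_M, mem_M_iff]
      simp [mem_M_iff.1 hxM]
    have h5 : Polynomial.aeval τ f = ((f.eval (a (j + 1)) : R) : T n) * (1 + x * c) := by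
      rw [mul_add, mul_one, ← mul_assoc, ← hc]
      ring
    rw [h5]
    exact associated_mul_unit_right _ _ hu
  refine ⟨τ, fun hτR => ?_, fun f => ?_⟩
  · obtain ⟨r, hr, hr'⟩ := key (Polynomial.X - Polynomial.C ⟨τ, hτR⟩) (Polynomial.X_sub_C_ne_zero _)
    have h0 : Polynomial.aeval τ (Polynomial.X - Polynomial.C (⟨τ, hτR⟩ : R)) = 0 := by
      rw [map_sub, Polynomial.aeval_X, Polynomial.aeval_C]
      exact sub_self τ
    rw [h0, associated_zero_iff_eq_zero] at hr'
    exact hr (Subtype.ext hr')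
  · rcases eq_or_ne f 0 with rfl | hf
    · exact ⟨0, by simp⟩
    · obtain ⟨r, -, hr⟩ := key f hf
      exact ⟨r, hr⟩

/-- The subring of those elements of `T` that are fractions of elements of `R`. -/
def fractions (R : Subring (T n)) : Subring (T n) where
  carrier := {t | ∃ b ∈ R, b ≠ 0 ∧ b * t ∈ R}
  mul_mem' := by
    rintro s t ⟨b, hb, hb0, hbs⟩ ⟨c, hc, hc0, hct⟩
    exact ⟨b * c, mul_mem hb hc, mul_ne_zero hb0 hc0, by
      simpa only [mul_mul_mul_comm] using mul_mem hbs hct⟩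
  one_mem' := ⟨1, one_mem R, one_ne_zero, by simp⟩
  add_mem' := by
    rintro s t ⟨b, hb, hb0, hbs⟩ ⟨c, hc, hc0, hct⟩
    refine ⟨b * c, mul_mem hb hc, mul_ne_zero hb0 hc0, ?_⟩
    have : b * c * (s + t) = c * (b * s) + b * (c * t) := by ring
    rw [this]
    exact add_mem (mul_mem hc hbs) (mul_mem hb hct)
  zero_mem' := ⟨1, one_mem R, one_ne_zero, by simp⟩
  neg_mem' := by
    rintro s ⟨b, hb, hb0, hbs⟩
    exact ⟨b, hb, hb0, by simpa using neg_mem hbs⟩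

theorem le_fractions (R : Subring (T n)) : R ≤ fractions R := fun r hr =>
  ⟨1, one_mem R, one_ne_zero, by simpa using hr⟩

/-- Every element of `R` is associated in `T` to an element of `S`. -/
def AssociatedTo (S R : Subring (T n)) : Prop :=
  ∀ r ∈ R, ∃ s ∈ S, Associated s r

/-- If `s`, `s'` in `S` are associated to `b`, `bt`, then `s` divides `s'` in `T`, hence in `S`; the
quotient is associated to `t`. -/
theorem AssociatedTo.fractions {S R : Subring (T n)}
    (hS : ∀ I : Ideal S, contract S (extend S I) = I) (h : AssociatedTo S R) :
    AssociatedTo S (fractions R) := by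
  rintro t ⟨b, hb, hb0, hbt⟩
  obtain ⟨s, hs, hsb⟩ := h b hb
  obtain ⟨s', hs', hsbt⟩ := h _ hbt
  have h1 : s ∣ s' := hsb.dvd.trans ((Dvd.intro t rfl).trans hsbt.symm.dvd)
  have h2 : (⟨s', hs'⟩ : S) ∈ contract S (extend S (Ideal.span {⟨s, hs⟩})) := by
    rw [mem_contract, extend, Ideal.map_span, Set.image_singleton]
    exact Ideal.mem_span_singleton.2 h1
  rw [hS, Ideal.mem_span_singleton] at h2
  obtain ⟨c, hc⟩ := h2
  have hc' : s' = s * c := congrArg Subtype.val hc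
  refine ⟨c, c.2, ?_⟩
  rw [hc'] at hsbt
  exact Associated.of_mul_left hsbt hsb (fun h0 => hb0 (by
    rw [h0] at hsb
    exact (associated_zero_iff_eq_zero b).1 hsb.symm))

/-- Associated elements lie in the same ideals of `T`, which gives the condition on primes; closure
under fractions gives the one on principal ideals. -/
theorem AssociatedTo.isFinalRing {S B : Subring (T n)} (hSB : S ≤ B) (h : AssociatedTo S B)
    (hB : ¬ (B : Set (T n)).Countable) (hfrac : PowerSeriesSubrings.fractions B ≤ B)
    (hl : IsQuasiLocal B) :
    IsFinalRing S B where
  uncountable := hB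
  quasiLocal := hl
  starSubring := by
    refine ⟨hSB, fun P hP hSP => ?_⟩
    rw [eq_bot_iff]
    intro b hb
    obtain ⟨s, hs, hsb⟩ := h b b.2
    have h1 : (⟨s, hs⟩ : S) ∈ contract S P := Ideal.mem_of_dvd P hsb.symm.dvd hb
    rw [hSP, Ideal.mem_bot] at h1
    have hs0 : s = 0 := congrArg Subtype.val h1
    rw [hs0] at hsb
    exact Subtype.ext ((associated_zero_iff_eq_zero _).1 hsb.symm)
  principal_closed := by
    rintro _ ⟨b, rfl⟩
    refine le_antisymm (fun c hc => ?_) (le_contract_extend _ _)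
    rw [mem_contract, extend, Ideal.submodule_span_eq, Ideal.map_span, Set.image_singleton,
      Ideal.mem_span_singleton] at hc
    obtain ⟨t, ht⟩ := hc
    rw [Ideal.submodule_span_eq, Ideal.mem_span_singleton]
    rcases eq_or_ne b 0 with rfl | hb0
    · rw [map_zero, zero_mul] at ht
      exact (Subtype.ext ht : c = 0) ▸ dvd_refl _
    · have htB : t ∈ B := hfrac ⟨b, b.2, fun h0 => hb0 (Subtype.ext h0), by
        change (B.subtype b) * t ∈ B
        rw [← ht]
        exact c.2⟩
      exact ⟨⟨t, htB⟩, Subtype.ext ht⟩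

theorem exists_maximal_associatedTo (S : Subring (T n)) :
    ∃ B, Maximal (fun B => S ≤ B ∧ AssociatedTo S B) B := by
  obtain ⟨B, -, hB⟩ := zorn_le_nonempty₀ {B | S ≤ B ∧ AssociatedTo S B} (by
    intro c hc hchain y hy
    refine ⟨sSup c, ⟨(hc hy).1.trans (le_sSup hy), fun r hr => ?_⟩, fun z hz => le_sSup hz⟩
    obtain ⟨R, hR, hrR⟩ := (Subring.mem_sSup_of_directedOn ⟨y, hy⟩ hchain.directedOn).1 hr
    exact (hc hR).2 r hrR) S ⟨le_rfl, fun s hs => ⟨s, hs, Associated.refl s⟩⟩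
  exact ⟨B, hB⟩

theorem exists_isFinalRing (hn : 0 < n) {S : Subring (T n)} (hS : IsBaseRing S) :
    ∃ B : Subring (T n), IsFinalRing S B := by
  have hreg := hS.regular
  obtain ⟨B, hB⟩ := exists_maximal_associatedTo S
  obtain ⟨hSB, hBS⟩ := hB.prop
  have hfrac : fractions B ≤ B := hB.le_of_ge ⟨hSB.trans (le_fractions B),
    hBS.fractions (contract_extend_of_hasCompletion hS.polynomials_le hS.quasiLocal
      hS.completion)⟩ (le_fractions B)
  refine ⟨B, hBS.isFinalRing hSB (fun hcount => ?_) hfrac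
    (isQuasiLocal_of_inv_mem fun r hr hrM => ?_)⟩
  -- If `B` were countable, `B[τ]` would contradict maximality.
  · obtain ⟨τ, hτ, hτB⟩ :=
      exists_transcendental_aeval_associated (hS.polynomials_le.trans hSB) hn hcount
    set B' : Subring (T n) := (Polynomial.aeval τ : Polynomial B →ₐ[B] T n).toRingHom.range
    have hBB' : B ≤ B' := fun b hb => ⟨Polynomial.C ⟨b, hb⟩, Polynomial.aeval_C τ _⟩
    have hle : B' ≤ B := hB.le_of_ge ⟨hSB.trans hBB', by
      rintro _ ⟨f, rfl⟩
      obtain ⟨r, hr⟩ := hτB f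
      obtain ⟨s, hs, hsr⟩ := hBS r r.2
      exact ⟨s, hs, hsr.trans hr⟩⟩ hBB'
    exact hτ (hle ⟨Polynomial.X, Polynomial.aeval_X τ⟩)
  · have hinv := MvPowerSeries.mul_inv_cancel r (mt mem_M_iff.2 hrM)
    refine ⟨r⁻¹, hfrac ⟨r, hr, ?_, hinv ▸ one_mem B⟩, hinv⟩
    rintro rfl
    exact hrM (zero_mem _)

end PowerSeriesSubrings

namespace PowerSeriesSubrings

variable {n : ℕ}

/-! ### Final rings -/

theorem exists_mem_isUnit_mul_eq_prod {S : Subring (T n)} (f : Multiset (T n))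
    (h : ∀ p ∈ f, ∃ u, IsUnit u ∧ p * u ∈ S) : ∃ s ∈ S, Associated f.prod s := by
  induction f using Multiset.induction_on with
  | empty => exact ⟨1, one_mem S, by simp⟩
  | cons p f ih =>
    obtain ⟨s, hs, hfs⟩ := ih fun q hq => h q (Multiset.mem_cons_of_mem hq)
    obtain ⟨u, hu, hpu⟩ := h p (Multiset.mem_cons_self p f)
    refine ⟨p * u * s, mul_mem hpu hs, ?_⟩
    rw [Multiset.prod_cons]
    exact (associated_mul_unit_right p u hu).mul_mul hfs

/-- For a prime factor `p` of `b`, the ideal `pT` meets `B` and therefore `S` nontrivially, so `S`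
contains an associate of `p`. -/
theorem exists_mem_associated {S B : Subring (T n)} (hS : ContainsFactors S)
    (hB : IsStarSubring S B) {b : T n} (hb : b ∈ B) : ∃ s ∈ S, Associated b s := by
  rcases eq_or_ne b 0 with rfl | hb0
  · exact ⟨0, zero_mem S, Associated.refl 0⟩
  obtain ⟨f, hf, hfb⟩ := UniqueFactorizationMonoid.exists_prime_factors b hb0
  obtain ⟨s, hs, hfs⟩ := exists_mem_isUnit_mul_eq_prod (S := S) f fun p hp => by
    have hpb : b ∈ Ideal.span {p} :=
      Ideal.mem_span_singleton.2 ((Multiset.dvd_prod hp).trans hfb.dvd)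
    have hP : (Ideal.span {p}).IsPrime :=
      (Ideal.span_singleton_prime (hf p hp).ne_zero).2 (hf p hp)
    have hBP : contract B (Ideal.span {p}) ≠ ⊥ := fun h0 => by
      have h1 : (⟨b, hb⟩ : B) ∈ contract B (Ideal.span {p}) := hpb
      rw [h0, Ideal.mem_bot] at h1
      exact hb0 (congrArg Subtype.val h1)
    obtain ⟨s, hs, hs0⟩ :=
      Submodule.exists_mem_ne_zero_of_ne_bot (mt (hB.2 _ hP) hBP)
    exact hS s s.2 (fun h => hs0 (Subtype.ext h)) p (hf p hp) hs
  exact ⟨s, hs, hfb.symm.trans hfs⟩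

/-- A principal ideal of `B` is determined by its extension to `T`, where associates generate the
same ideal. -/
theorem IsFinalRing.exists_mem_span_singleton_eq {S B : Subring (T n)} (hS : ContainsFactors S)
    (hB : IsFinalRing S B) (b : B) :
    ∃ s : B, (s : T n) ∈ S ∧ Ideal.span {b} = Ideal.span {s} := by
  obtain ⟨s, hs, hbs⟩ := exists_mem_associated hS hB.starSubring b.2
  refine ⟨⟨s, hB.starSubring.1 hs⟩, hs, ?_⟩
  rw [← hB.principal_closed (Ideal.span {b}) ⟨b, rfl⟩,
    ← hB.principal_closed (Ideal.span {(⟨s, hB.starSubring.1 hs⟩ : B)}) ⟨_, rfl⟩]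
  congr 1
  simp only [extend, Ideal.map_span, Set.image_singleton]
  exact Ideal.span_singleton_eq_span_singleton.2 hbs

theorem IsFinalRing.exists_finset_eq_span {S B : Subring (T n)} (hS : ContainsFactors S)
    (hB : IsFinalRing S B) {I : Ideal B} (hI : I.FG) :
    ∃ G : Finset B, (∀ g ∈ G, (g : T n) ∈ S) ∧ I = Ideal.span (G : Set B) := by
  classical
  obtain ⟨G, rfl⟩ := hI
  choose σ hσS hσ using hB.exists_mem_span_singleton_eq hS
  refine ⟨G.image σ, ?_, le_antisymm ?_ ?_⟩
  · intro g hg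
    obtain ⟨b, -, rfl⟩ := Finset.mem_image.1 hg
    exact hσS b
  · refine Ideal.span_le.2 fun b hb => ?_
    have h1 : b ∈ Ideal.span {σ b} := hσ b ▸ Ideal.mem_span_singleton_self b
    refine Ideal.span_mono ?_ h1
    rw [Set.singleton_subset_iff, Finset.coe_image]
    exact ⟨b, hb, rfl⟩
  · refine Ideal.span_le.2 ?_
    rw [Finset.coe_image]
    rintro _ ⟨b, hb, rfl⟩
    have h1 : σ b ∈ Ideal.span {b} := hσ b ▸ Ideal.mem_span_singleton_self (σ b)
    exact Ideal.span_mono (Set.singleton_subset_iff.2 hb) h1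

theorem IsFinalRing.contract_extend {S B : Subring (T n)} (hS : IsBaseRing S)
    (hB : IsFinalRing S B) {I : Ideal B} (hI : I.FG) : contract B (extend B I) = I := by
  have hreg := hS.regular
  refine le_antisymm (fun c hc => ?_) (le_contract_extend _ _)
  obtain ⟨G, hGS, rfl⟩ := hB.exists_finset_eq_span hS.containsFactors hI
  obtain ⟨s, hs, hcs⟩ := hB.exists_mem_span_singleton_eq hS.containsFactors c
  -- `J = I ∩ S` contains the generators `G`, so `IT ⊆ JT`, and `JT ∩ S = J` because `S` is
  -- Noetherian with completion `T`.
  set J : Ideal S := (Ideal.span (G : Set B)).comap (Subring.inclusion hB.starSubring.1)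
  have hle : extend B (Ideal.span (G : Set B)) ≤ extend S J := by
    rw [extend, Ideal.map_span, Ideal.span_le]
    rintro _ ⟨g, hg, rfl⟩
    exact mem_extend_of_mem (I := J) (r := ⟨g, hGS g hg⟩) (Ideal.subset_span hg)
  have hsc : s ∈ contract B (extend B (Ideal.span (G : Set B))) := by
    have h1 : s ∈ Ideal.span {c} := hcs ▸ Ideal.mem_span_singleton_self s
    exact (Ideal.span_singleton_le_iff_mem _).2 hc h1
  have hsJ : (⟨s, hs⟩ : S) ∈ contract S (extend S J) := hle hsc
  rw [contract_extend_of_hasCompletion hS.polynomials_le hS.quasiLocal hS.completion] at hsJ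
  have hsI : s ∈ Ideal.span (G : Set B) := hsJ
  have hcI : c ∈ Ideal.span {s} := hcs ▸ Ideal.mem_span_singleton_self c
  exact (Ideal.span_singleton_le_iff_mem _).2 hsI hcI

end PowerSeriesSubrings

theorem mainTheorem4 (n : ℕ) (hn : 2 ≤ n) :
    (∃ S : Subring (PowerSeriesSubrings.T n), PowerSeriesSubrings.IsBaseRing S) ∧
    ∀ S : Subring (PowerSeriesSubrings.T n), PowerSeriesSubrings.IsBaseRing S →
      (∃ B : Subring (PowerSeriesSubrings.T n), PowerSeriesSubrings.IsFinalRing S B) ∧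
      ∀ B : Subring (PowerSeriesSubrings.T n), PowerSeriesSubrings.IsFinalRing S B →
        (∀ I : Ideal B, I.FG →
          ∃ G : Finset B, (∀ g ∈ G, (g : PowerSeriesSubrings.T n) ∈ S) ∧
            I = Ideal.span (G : Set B)) ∧
        (∀ I : Ideal B, I.FG →
          PowerSeriesSubrings.contract B (PowerSeriesSubrings.extend B I) = I) ∧
        IsNoetherianRing B ∧
        PowerSeriesSubrings.HasCompletionT B ∧
        IsRegularLocalRing B := by
  refine ⟨PowerSeriesSubrings.exists_isBaseRing n, fun S hS =>
    ⟨PowerSeriesSubrings.exists_isFinalRing (by omega) hS, fun B hB => ?_⟩⟩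
  have hR := hS.polynomials_le.trans hB.starSubring.1
  have hclosed : ∀ I : Ideal B, I.FG →
      PowerSeriesSubrings.contract B (PowerSeriesSubrings.extend B I) = I :=
    fun I hI => hB.contract_extend hS hI
  exact ⟨fun I hI => hB.exists_finset_eq_span hS.containsFactors hI, hclosed,
    PowerSeriesSubrings.isNoetherianRing_of_contract_extend hclosed,
    PowerSeriesSubrings.hasCompletionT_of_contract_extend hR hclosed,
    PowerSeriesSubrings.isRegularLocalRing_of_contract_extend hR hB.quasiLocal hclosed⟩
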